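/- Let $1\le k\le d$, $n\ge 1$, $\alpha>0$, $b>0$. For $x\in\mathbb R^d$ let $A_x\in\mathbb R^{d\times k}$ be the matrix with entries $(A_x)_{ij}=x_{i+j-1}$ ($0$ if the index exceeds $d$), and for $w=(w_1,w_2)\in\mathbb R^k\times\mathbb R^d$ let $f_w(x)=w_1^TA_x^Tw_2=\sum_{i=1}^d w_{2,i}\sum_{j=1}^k w_{1,j}x_{i+j-1}$ (Model-Conv-$k$). Let $\mathcal D$ be the uniform distribution over the $2d$ labelled points $(e_l,+1)$, $(-e_l,-1)$, $l\in[d]=\{1,\dots,d\}$ (Task-Cls), where $e_l$ is the $l$-th standard basis vector. Let $D_{\mathrm{tr}}$ be a training set of $n$ independent samples from $\mathcal D$, let $M_{\mathrm{tr}}=\frac1n\sum_{(x,y)\in D_{\mathrm{tr}}}yA_x$, let $\sigma_1$ be the largest singular value of $M_{\mathrm{tr}}$, and let $S_{\mathrm{tr}}$ be the set of $l\in[d]$ such that $e_l$ or $-e_l$ occurs as an input in $D_{\mathrm{tr}}$. Let $w_1^0\sim\mathcal N(0,b^2I_k)$ be independent of $D_{\mathrm{tr}}$, let $w_2^0=0$,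 and let $w^{t+1}=w^t-\alpha\nabla_w\mathcal L(w^t)$ be gradient descent on the extreme hinge loss $\mathcal L(w)=\frac1n\sum_{(x,y)\in D_{\mathrm{tr}}}\bigl(-yf_w(x)\bigr)$. Put $w^\infty=\lim_{t\to\infty}\dfrac{2w^t}{(1+\alpha\sigma_1)^t}$, $\bar{\mathcal E}(z)=\mathbf 1\{z<0\}+\frac12\mathbf 1\{z=0\}$, and define the asymptotic generalization error $$\mathcal E^\infty=\mathbb E_{D_{\mathrm{tr}},\,w_1^0}\Bigl[\mathbb E_{(x,y)\sim\mathcal D}\bigl[\bar{\mathcal E}\bigl(yf_{w^\infty}(x)\bigr)\bigr]\Bigr].$$ Call a non-negative matrix $A\in\mathbb R^{k\times k}$ primitive if there is an integer $t\ge1$ such that $(A^t)_{ij}>0$ for all $i,j$. Then the limit $w^\infty$ exists (for every training set in $(\mathbb R^d\times\mathbb R)^n$ and every $w_1^0$), the expectation defining $\mathcal E^\infty$ exists, and $$\mathcal E^\infty\;\le\;\mathbb P\bigl(M_{\mathrm{tr}}^TM_{\mathrm{tr}}\text{ is not primitive}\bigr)+\frac12\,\mathbb E_{l\sim\mathcal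 U([d])}\Bigl[\mathbb P\bigl(\forall\,l'\in S_{\mathrm{tr}}:\ |l'-l|\ge k\bigr)\Bigr],$$ where $\mathcal U([d])$ is the uniform distribution on $[d]$. -/

import Mathlib

open MeasureTheory ProbabilityTheory Filter Topology Matrix

noncomputable section

namespace ConvNet

/-- A labelled data point `(x, y)`, with input `x ∈ ℝ^d` and label `y`. -/
abbrev DataPoint (d : ℕ) : Type := (Fin d → ℝ) × ℝ

/-- A training set of size `n`: the list of the sampled data points (repetitions allowed). -/
abbrev TrainSet (d n : ℕ) : Type := Fin n → DataPoint d

/-- The weights `w = (w₁, w₂)` with the filter `w₁ ∈ ℝ^k` (left summand of the index type) and the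
output layer `w₂ ∈ ℝ^d` (right summand), as a point of the Euclidean space `ℝ^(k+d)`. -/
abbrev Weights (d k : ℕ) : Type := EuclideanSpace ℝ (Fin k ⊕ Fin d)

/-- The matrix `A_x = [x, x_{←1}, …, x_{←(k-1)}]`: with indices starting from `0`, its `(i, j)` entry
is `x_{i+j}`, and `0` if this index is out of range. -/
def shiftMatrix {d : ℕ} (k : ℕ) (x : Fin d → ℝ) : Matrix (Fin d) (Fin k) ℝ :=
  Matrix.of fun i j => if h : (i : ℕ) + (j : ℕ) < d then x ⟨(i : ℕ) + (j : ℕ), h⟩ else 0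

/-- The two-layer convolutional linear network
`f_w(x) = ∑_i w_{2,i} ∑_j w_{1,j} x_{i+j}` (out-of-range entries of `x` are zero). -/
def convNet {d k : ℕ} (w : Weights d k) (x : Fin d → ℝ) : ℝ :=
  ∑ i : Fin d, w (Sum.inr i) * ∑ j : Fin k, w (Sum.inl j) * shiftMatrix k x i j

/-- The training loss for the extreme hinge loss `ℓ(w; x, y) = - y f_w(x)`. -/
def xHingeLoss {d k n : ℕ} (D : TrainSet d n) (w : Weights d k) : ℝ :=
  (1 / (n : ℝ)) * ∑ s : Fin n, -((D s).2 * convNet w (D s).1)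

/-- The initial weights `(w₁⁰, 0)`. -/
def initWeights {k : ℕ} (d : ℕ) (w₁ : EuclideanSpace ℝ (Fin k)) : Weights d k :=
  WithLp.toLp 2 (Sum.elim (fun j => w₁ j) (fun _ => 0))

/-- The iterates `w^{t+1} = w^t - α ∇L(w^t)` of full-batch gradient descent on the extreme hinge
loss with learning rate `α`, started from `(w₁⁰, 0)`. -/
def gdIterate {d k n : ℕ} (α : ℝ) (D : TrainSet d n) (w₁ : EuclideanSpace ℝ (Fin k)) :
    ℕ → Weights d k
  | 0 => initWeights d w₁
  | t + 1 => gdIterate α D w₁ t - α • gradient (xHingeLoss D) (gdIterate α D w₁ t)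

/-- The matrix `M_tr = (1/n) ∑_{(x,y) ∈ D} y A_x`. -/
def trainMatrix {d n : ℕ} (k : ℕ) (D : TrainSet d n) : Matrix (Fin d) (Fin k) ℝ :=
  (1 / (n : ℝ)) • ∑ s : Fin n, (D s).2 • shiftMatrix k (D s).1

/-- The largest singular value of a real matrix. -/
def topSingularValue {d k : ℕ} (M : Matrix (Fin d) (Fin k) ℝ) : ℝ :=
  (Matrix.toEuclideanLin M).singularValues 0

/-- The rescaled iterates `2 w^t / (1 + α σ₁)^t`, where `σ₁` is the top singular value of
`M_tr`. -/
def scaledIterate {d k n : ℕ} (α : ℝ) (D : TrainSet d n) (w₁ : EuclideanSpace ℝ (Fin k))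
    (t : ℕ) : Weights d k :=
  (2 / (1 + α * topSingularValue (trainMatrix k D)) ^ t) • gdIterate α D w₁ t

/-- The asymptotic weights `w^∞ = lim_{t → ∞} 2 w^t / (1 + α σ₁)^t`. -/
def limitWeights {d k n : ℕ} (α : ℝ) (D : TrainSet d n) (w₁ : EuclideanSpace ℝ (Fin k)) :
    Weights d k :=
  limUnder atTop (scaledIterate α D w₁)

/-- The error `1{z < 0} + (1/2) 1{z = 0}` of the sign prediction with margin `z = y f_w(x)`; a
random label is predicted if `z = 0`. -/
def marginError (z : ℝ) : ℝ :=
  (if z < 0 then 1 else 0) + (1 / 2) * (if z = 0 then 1 else 0)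

/-- The generalization error `E_{(x,y) ∼ P} [1{y f_w(x) < 0} + (1/2) 1{y f_w(x) = 0}]`. -/
def genError {d k : ℕ} (P : Measure (DataPoint d)) (w : Weights d k) : ℝ :=
  ∫ p, marginError (p.2 * convNet w p.1) ∂P

/-- The law of a training set of `n` independent samples from `P`. -/
def trainLaw {d : ℕ} (P : Measure (DataPoint d)) (n : ℕ) : Measure (TrainSet d n) :=
  Measure.pi fun _ => P

/-- The Gaussian law `N(0, b² I_k)` of the initial filter. -/
def filterLaw (k : ℕ) (b : ℝ) : Measure (EuclideanSpace ℝ (Fin k)) :=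
  multivariateGaussian 0 (b ^ 2 • (1 : Matrix (Fin k) (Fin k) ℝ))

/-- The asymptotic generalization error `E_{D_tr, w₁⁰} [ℰ(w^∞; P)]`, with `D_tr` and `w₁⁰`
independent. -/
def asymGenError {d : ℕ} (P : Measure (DataPoint d)) (k n : ℕ) (α b : ℝ) : ℝ :=
  ∫ q : TrainSet d n × EuclideanSpace ℝ (Fin k), genError P (limitWeights α q.1 q.2)
    ∂((trainLaw P n).prod (filterLaw k b))

/-- The `2d` data points `(e_l, +1)` and `(-e_l, -1)` of the classification task. -/
def taskClsData (d : ℕ) : Set (DataPoint d) :=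
  {p | ∃ l : Fin d, p = (Pi.single l 1, 1) ∨ p = (-Pi.single l 1, -1)}

/-- The data distribution of the classification task: uniform over its `2d` data points. -/
def taskCls (d : ℕ) : Measure (DataPoint d) :=
  uniformOn (taskClsData d)

/-- The set `S_tr` of the positions `l` such that `e_l` or `-e_l` appears in the training set. -/
def trainPositions {d n : ℕ} (D : TrainSet d n) : Set (Fin d) :=
  {l | ∃ s : Fin n, (D s).1 = Pi.single l 1 ∨ (D s).1 = -Pi.single l 1}

end ConvNet

end

/-! With M the training matrix, the extreme hinge loss is the quadratic form -w₂ᵀ M w₁. Gradient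
descent is therefore a linear power iteration w ↦ w + αTw with the symmetric operator T(w₁, w₂) =
(Mᵀw₂, Mw₁). The eigenvalues of T lie in [-σ₁, σ₁], so rescaling by (1 + ασ₁)^t kills every
eigencomponent except the one for σ₁, and w^∞ is twice the projection of w⁰ onto that eigenspace
(`exists_tendsto_rescaled_iterate`, `inner_rescaled_limit`).

If MᵀM is primitive, Perron–Frobenius (`eigenvector_mul_pos_of_isPrimitive`) gives σ₁ > 0 and makes
the entries of every top eigenvector of MᵀM share one strict sign. A Gaussian filter is almost
surely not orthogonal to such an eigenvector, so the limiting filter w₁ is itself a top eigenvector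
and w₂ = σ₁⁻¹ M w₁ (`exists_limitWeights_pos`).

On this task M has non-negative entries. The margin at ±e_l is then σ₁⁻¹ ∑ᵢ (Mw₁)ᵢ (A_{e_l}w₁)ᵢ, a
sum of non-negative terms: the error at l is at most 1/2. It is 0 once some row window of length k
covers both l and a seen position, that is, once a seen position is at distance less than k
(`genError_le_of_limit_form`). In the non-primitive case the error is bounded by 1, and integration
gives the two terms of the bound. -/

noncomputable section

namespace ConvNet

/-! ### Rescaled power iteration of a symmetric operator -/

/-- The linear recursion `u (t+1) = u t + α T (u t)` with a symmetric operator `T` whose eigenvalues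
are bounded by `σ` in absolute value, rescaled by `(1 + α σ) ^ t`, converges to a solution of
`T y = σ y`. -/
theorem exists_tendsto_rescaled_iterate {E : Type*} [NormedAddCommGroup E] [InnerProductSpace ℝ E]
    [FiniteDimensional ℝ E] {T : E →ₗ[ℝ] E} (hT : T.IsSymmetric) {α σ : ℝ} (hα : 0 < α)
    (hσ : 0 ≤ σ) (hbound : ∀ μ : ℝ, Module.End.HasEigenvalue T μ → |μ| ≤ σ) {u : ℕ → E}
    (hu : ∀ t, u (t + 1) = u t + α • T (u t)) (c : ℝ) :
    ∃ y : E, Tendsto (fun t => (c / (1 + α * σ) ^ t) • u t) atTop (𝓝 y) ∧ T y = σ • y := by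
  set e := hT.eigenvectorBasis rfl
  set lam := hT.eigenvalues rfl
  have hpos : 0 < 1 + α * σ := by positivity
  have hcoord : ∀ i t, e.repr (u t) i = (1 + α * lam i) ^ t * e.repr (u 0) i := by
    intro i t
    induction t with
    | zero => simp
    | succ t ih =>
      have h1 : e.repr (T (u t)) i = lam i * e.repr (u t) i := by
        simpa using hT.eigenvectorBasis_apply_self_apply rfl (u t) i
      rw [hu, map_add, map_smul, PiLp.add_apply, PiLp.smul_apply, h1, ih, smul_eq_mul]
      ring
  -- The limit is c times the projection of `u 0` onto the σ-eigenspace; it is 0 if σ is not an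
  -- eigenvalue.
  refine ⟨∑ i, (if lam i = σ then c * e.repr (u 0) i else 0) • e i, ?_, ?_⟩
  · have hsum : ∀ t, (c / (1 + α * σ) ^ t) • u t =
        ∑ i, (c * e.repr (u 0) i * ((1 + α * lam i) / (1 + α * σ)) ^ t) • e i := by
      intro t
      conv_lhs => rw [← e.sum_repr (u t)]
      rw [Finset.smul_sum]
      refine Finset.sum_congr rfl fun i _ => ?_
      rw [smul_smul, hcoord, div_pow]
      congr 1
      ring
    simp_rw [hsum]
    refine tendsto_finsetSum _ fun i _ => Tendsto.smul_const ?_ _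
    have hi := abs_le.1 (hbound (lam i) (hT.hasEigenvalue_eigenvalues rfl i))
    split_ifs with h
    · rw [h, div_self hpos.ne']
      simp
    · have hlt : lam i < σ := lt_of_le_of_ne hi.2 h
      -- The summand 1 makes the eigenvalue -σ strictly subdominant too: 1 - ασ > -(1 + ασ). Hence α
      -- need not be small.
      have habs : |(1 + α * lam i) / (1 + α * σ)| < 1 := by
        rw [abs_div, abs_of_pos hpos, div_lt_one hpos, abs_lt]
        constructor <;> nlinarith
      simpa using (tendsto_pow_atTop_nhds_zero_of_abs_lt_one habs).const_mul
        (c * e.repr (u 0) i)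
  · rw [map_sum, Finset.smul_sum]
    refine Finset.sum_congr rfl fun i _ => ?_
    have h1 : T (e i) = lam i • e i :=
      hT.apply_eigenvectorBasis rfl i
    rw [map_smul, h1]
    split_ifs with h
    · rw [h, smul_comm]
    · simp

/-- Along the recursion `u (t+1) = u t + α T (u t)`, the component in the direction of an
eigenvector for the eigenvalue `σ` is preserved by the rescaling with `(1 + α σ) ^ t`. -/
theorem inner_rescaled_limit {E : Type*} [NormedAddCommGroup E] [InnerProductSpace ℝ E]
    {T : E →ₗ[ℝ] E} (hT : T.IsSymmetric) {α σ c : ℝ} (hpos : 0 < 1 + α * σ) {u : ℕ → E}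
    (hu : ∀ t, u (t + 1) = u t + α • T (u t)) {y v : E}
    (hy : Tendsto (fun t => (c / (1 + α * σ) ^ t) • u t) atTop (𝓝 y)) (hv : T v = σ • v) :
    inner ℝ y v = c * inner ℝ (u 0) v := by
  have hstep : ∀ t, inner ℝ (u t) v = (1 + α * σ) ^ t * inner ℝ (u 0) v := by
    intro t
    induction t with
    | zero => simp
    | succ t ih =>
      rw [hu, inner_add_left, real_inner_smul_left, hT, hv, real_inner_smul_right, ih]
      ring
  refine tendsto_nhds_unique (hy.inner (tendsto_const_nhds (x := v))) ?_
  refine tendsto_const_nhds.congr fun t => ?_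
  rw [real_inner_smul_left, hstep t]
  have := (pow_pos hpos t).ne'
  rw [← mul_assoc, div_mul_cancel₀ _ this]

/-! ### The largest singular value -/

/-- The square of the largest singular value is an eigenvalue of the Gram matrix. -/
theorem exists_gram_eigenvector {d k : ℕ} (hk : 0 < k) (M : Matrix (Fin d) (Fin k) ℝ) :
    ∃ x : Fin k → ℝ, x ≠ 0 ∧ (Mᵀ * M) *ᵥ x = topSingularValue M ^ 2 • x := by
  obtain ⟨x, hx⟩ := ((toEuclideanLin M).hasEigenvalue_adjoint_comp_self_sq_singularValues
    (n := 0) (by simpa using hk)).exists_hasEigenvector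
  refine ⟨x.ofLp, by simpa using hx.2, ?_⟩
  have h := hx.apply_eq_smul
  rw [← toEuclideanLin_conjTranspose_eq_adjoint] at h
  have h2 := congrArg WithLp.ofLp h
  simpa [topSingularValue] using h2

/-- The square of the largest singular value bounds the quadratic form of the Gram matrix. -/
theorem posSemidef_topSingularValue_sub_gram {d k : ℕ} (M : Matrix (Fin d) (Fin k) ℝ) :
    (topSingularValue M ^ 2 • (1 : Matrix (Fin k) (Fin k) ℝ) - Mᵀ * M).PosSemidef := by
  set T := toEuclideanLin M
  have hS := T.isSymmetric_adjoint_comp_self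
  have hherm : (topSingularValue M ^ 2 • (1 : Matrix (Fin k) (Fin k) ℝ) - Mᵀ * M).IsHermitian := by
    simp [IsHermitian, conjTranspose_eq_transpose_of_trivial]
  refine PosSemidef.of_dotProduct_mulVec_nonneg hherm fun x => ?_
  set z : EuclideanSpace ℝ (Fin k) := WithLp.toLp 2 x
  have key : inner ℝ z ((T.adjoint ∘ₗ T) z) ≤ topSingularValue M ^ 2 * inner ℝ z z := by
    set e := hS.eigenvectorBasis rfl
    rw [← e.sum_inner_mul_inner z ((T.adjoint ∘ₗ T) z), ← e.sum_inner_mul_inner z z,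
      Finset.mul_sum]
    refine Finset.sum_le_sum fun i _ => ?_
    have h1 : inner ℝ (e i) ((T.adjoint ∘ₗ T) z) = hS.eigenvalues rfl i * inner ℝ (e i) z := by
      rw [← hS, hS.apply_eigenvectorBasis]
      simp [real_inner_smul_left, e]
    have h2 : hS.eigenvalues rfl i ≤ topSingularValue M ^ 2 := by
      rw [← T.sq_singularValues_fin rfl]
      exact pow_le_pow_left₀ (T.singularValues_nonneg _)
        (T.singularValues_antitone (Nat.zero_le _)) 2
    rw [h1, real_inner_comm]
    nlinarith [sq_nonneg (inner ℝ (e i) z)]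
  have h3 : inner ℝ z ((T.adjoint ∘ₗ T) z) = x ⬝ᵥ ((Mᵀ * M) *ᵥ x) := by
    rw [← toEuclideanLin_conjTranspose_eq_adjoint]
    simp [T, EuclideanSpace.inner_eq_star_dotProduct, z, dotProduct_comm]
  have h4 : inner ℝ z z = x ⬝ᵥ x := by
    rw [EuclideanSpace.inner_eq_star_dotProduct, star_trivial]
  rw [h3, h4] at key
  simpa [sub_mulVec, smul_mulVec, dotProduct_sub] using key

/-! ### Perron–Frobenius for symmetric primitive matrices -/

/-- If a symmetric matrix is primitive and `s` is its largest eigenvalue, then `s > 0` and the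
entries of an eigenvector for `s` all have the same strict sign. -/
theorem eigenvector_mul_pos_of_isPrimitive {k : ℕ} {N : Matrix (Fin k) (Fin k) ℝ}
    (hN : N.IsPrimitive) {s : ℝ}
    (hs : (s • (1 : Matrix (Fin k) (Fin k) ℝ) - N).PosSemidef) {x : Fin k → ℝ} (hx : x ≠ 0)
    (hxs : N *ᵥ x = s • x) : 0 < s ∧ ∀ i j, 0 < x i * x j := by
  -- Absolute values preserve the norm and do not decrease the form of a non-negative matrix, so |z|
  -- also maximizes the Rayleigh quotient. A vector on which a semidefinite form vanishes lies in
  -- its kernel.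
  have habs : ∀ z : Fin k → ℝ, N *ᵥ z = s • z → N *ᵥ |z| = s • |z| := by
    intro z hz
    have h0 : star |z| ⬝ᵥ ((s • (1 : Matrix (Fin k) (Fin k) ℝ) - N) *ᵥ |z|) = 0 := by
      refine le_antisymm ?_ (hs.dotProduct_mulVec_nonneg _)
      have h1 : |z| ⬝ᵥ |z| = z ⬝ᵥ z := by simp [dotProduct]
      have h2 : z ⬝ᵥ (N *ᵥ z) ≤ |z| ⬝ᵥ (N *ᵥ |z|) := by
        simp only [dotProduct, mulVec, Finset.mul_sum]
        refine Finset.sum_le_sum fun i _ => Finset.sum_le_sum fun j _ => ?_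
        refine (le_abs_self _).trans_eq ?_
        simp [abs_mul, abs_of_nonneg (hN.nonneg i j)]
      rw [hz] at h2
      simp only [star_trivial, sub_mulVec, smul_mulVec, one_mulVec, dotProduct_sub,
        dotProduct_smul, smul_eq_mul] at h2 ⊢
      rw [h1]
      linarith
    have h3 := (hs.dotProduct_mulVec_zero_iff _).1 h0
    rw [sub_mulVec, smul_mulVec, one_mulVec, sub_eq_zero] at h3
    exact h3.symm
  -- An entrywise positive power of `N` maps |z| to a vector with no zero entry, and that vector is
  -- a multiple of |z|. As the exponent is positive, this also excludes s = 0.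
  have hentry : ∀ z : Fin k → ℝ, z ≠ 0 → N *ᵥ z = s • z → 0 < s ∧ ∀ i, z i ≠ 0 := by
    intro z hz0 hz
    obtain ⟨t, ht, hpos⟩ := hN.exists_pos_pow
    have hpow : ∀ t : ℕ, N ^ t *ᵥ |z| = s ^ t • |z| := by
      intro t
      induction t with
      | zero => simp
      | succ t ih =>
        rw [pow_succ, ← mulVec_mulVec, habs z hz, mulVec_smul, ih, smul_smul, pow_succ']
    have hstrict : ∀ i, 0 < s ^ t * |z i| := by
      intro i
      have h := congrFun (hpow t) i
      simp only [Pi.smul_apply, smul_eq_mul, Pi.abs_apply] at h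
      rw [← h]
      obtain ⟨j, hj⟩ := Function.ne_iff.1 hz0
      refine Finset.sum_pos' (fun j _ => mul_nonneg (hpos i j).le (abs_nonneg _))
        ⟨j, Finset.mem_univ _, mul_pos (hpos i j) (abs_pos.2 hj)⟩
    refine ⟨?_, fun i hi => by simpa [hi] using hstrict i⟩
    obtain ⟨i, hi⟩ := Function.ne_iff.1 hz0
    have h := congrFun (habs z hz) i
    simp only [Pi.smul_apply, smul_eq_mul, Pi.abs_apply] at h
    have hnn : 0 ≤ s * |z i| := by
      rw [← h]
      simp only [mulVec, dotProduct, Pi.abs_apply]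
      exact Finset.sum_nonneg fun j _ => mul_nonneg (hN.nonneg i j) (abs_nonneg _)
    have hs0 : 0 ≤ s := nonneg_of_mul_nonneg_left hnn (abs_pos.2 hi)
    refine lt_of_le_of_ne hs0 fun h0 => ?_
    have := hstrict i
    simp [← h0, ht.ne'] at this
  obtain ⟨hs0, hne⟩ := hentry x hx hxs
  refine ⟨hs0, fun i j => ?_⟩
  -- This combination solves the eigenvector equation for s and vanishes at coordinate i, so
  -- `hentry` forces it to be zero: x is proportional to |x|.
  have hzero : x i • |x| - |x i| • x = 0 := by
    by_contra hcon
    refine (hentry _ hcon ?_).2 i ?_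
    · rw [mulVec_sub, mulVec_smul, mulVec_smul, habs x hxs, hxs, smul_sub, smul_comm s,
        smul_comm s]
    · simp [mul_comm]
  have hj := congrFun hzero j
  simp only [Pi.sub_apply, Pi.smul_apply, Pi.abs_apply, smul_eq_mul, Pi.zero_apply] at hj
  have h1 : x i * x j * |x j| = |x i| * (x j * x j) := by
    linear_combination x j * hj
  have h2 : 0 < |x i| * (x j * x j) :=
    mul_pos (abs_pos.2 (hne i)) (mul_self_pos.2 (hne j))
  exact pos_of_mul_pos_left (h1 ▸ h2) (abs_nonneg _)

/-! ### The linear dynamics of gradient descent -/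

/-- The symmetric operator `(w₁, w₂) ↦ (Mᵀ w₂, M w₁)`. -/
def crossOperator {d k : ℕ} (M : Matrix (Fin d) (Fin k) ℝ) : Weights d k →ₗ[ℝ] Weights d k :=
  toEuclideanLin (fromBlocks 0 Mᵀ M 0)

theorem crossOperator_isSymmetric {d k : ℕ} (M : Matrix (Fin d) (Fin k) ℝ) :
    (crossOperator M).IsSymmetric := by
  rw [crossOperator, isSymmetric_toEuclideanLin_iff, IsHermitian, fromBlocks_conjTranspose]
  simp [conjTranspose_eq_transpose_of_trivial]

/-- The filter part of a weight vector. -/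
def filterPart {d k : ℕ} (w : Weights d k) : Fin k → ℝ := fun j => w (Sum.inl j)

/-- The output-layer part of a weight vector. -/
def outputPart {d k : ℕ} (w : Weights d k) : Fin d → ℝ := fun i => w (Sum.inr i)

theorem weights_ext {d k : ℕ} {v w : Weights d k} (h₁ : filterPart v = filterPart w)
    (h₂ : outputPart v = outputPart w) : v = w := by
  ext i
  cases i with
  | inl j => exact congrFun h₁ j
  | inr i => exact congrFun h₂ i

theorem inner_weights {d k : ℕ} (v w : Weights d k) :
    inner ℝ v w = filterPart v ⬝ᵥ filterPart w + outputPart v ⬝ᵥ outputPart w := by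
  simp [PiLp.inner_apply, Fintype.sum_sum_type, filterPart, outputPart, dotProduct, mul_comm]

theorem filterPart_crossOperator {d k : ℕ} (M : Matrix (Fin d) (Fin k) ℝ) (w : Weights d k) :
    filterPart (crossOperator M w) = Mᵀ *ᵥ outputPart w := by
  ext j
  simp [filterPart, outputPart, crossOperator, mulVec, dotProduct, Fintype.sum_sum_type,
    fromBlocks]

theorem outputPart_crossOperator {d k : ℕ} (M : Matrix (Fin d) (Fin k) ℝ) (w : Weights d k) :
    outputPart (crossOperator M w) = M *ᵥ filterPart w := by
  ext j
  simp [filterPart, outputPart, crossOperator, mulVec, dotProduct, Fintype.sum_sum_type,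
    fromBlocks]

theorem convNet_eq {d k : ℕ} (w : Weights d k) (x : Fin d → ℝ) :
    convNet w x = outputPart w ⬝ᵥ (shiftMatrix k x *ᵥ filterPart w) := by
  simp [convNet, outputPart, filterPart, dotProduct, mulVec, mul_comm]

/-- The factor 1/2 appears because the two off-diagonal blocks each contribute the bilinear form w₂ᵀ
M w₁. -/
theorem xHingeLoss_eq {d k n : ℕ} (D : TrainSet d n) (w : Weights d k) :
    xHingeLoss D w = -(1 / 2) * inner ℝ (crossOperator (trainMatrix k D) w) w := by
  have h1 : inner ℝ (crossOperator (trainMatrix k D) w) w =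
      2 * (outputPart w ⬝ᵥ (trainMatrix k D *ᵥ filterPart w)) := by
    rw [inner_weights, filterPart_crossOperator, outputPart_crossOperator, mulVec_transpose,
      ← dotProduct_mulVec, dotProduct_comm (trainMatrix k D *ᵥ _)]
    ring
  have h2 : outputPart w ⬝ᵥ (trainMatrix k D *ᵥ filterPart w) =
      (1 / (n : ℝ)) * ∑ s, (D s).2 * convNet w (D s).1 := by
    simp only [trainMatrix, smul_mulVec, dotProduct_smul, sum_mulVec, dotProduct_sum, convNet_eq,
      smul_eq_mul]
  rw [h1, h2, xHingeLoss, Finset.sum_neg_distrib]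
  ring

theorem gradient_xHingeLoss {d k n : ℕ} (D : TrainSet d n) (w : Weights d k) :
    gradient (xHingeLoss D) w = -crossOperator (trainMatrix k D) w := by
  set T := crossOperator (trainMatrix k D)
  have hT : T.IsSymmetric := crossOperator_isSymmetric _
  have hfun : xHingeLoss D = fun w => -(1 / 2) * inner ℝ (T.toContinuousLinearMap w) w := by
    ext w
    exact xHingeLoss_eq D w
  refine HasGradientAt.gradient (hasGradientAt_iff_hasFDerivAt.2 ?_)
  rw [hfun]
  refine (((T.toContinuousLinearMap.hasFDerivAt (x := w)).inner ℝ
    (hasFDerivAt_id w)).const_mul (-(1 / 2))).congr_fderiv ?_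
  ext v
  have : inner ℝ (T v) w = inner ℝ (T w) v := by rw [hT, real_inner_comm]
  simp [this]
  ring

theorem gdIterate_succ {d k n : ℕ} (α : ℝ) (D : TrainSet d n) (w₁ : EuclideanSpace ℝ (Fin k))
    (t : ℕ) : gdIterate α D w₁ (t + 1) =
      gdIterate α D w₁ t + α • crossOperator (trainMatrix k D) (gdIterate α D w₁ t) := by
  rw [gdIterate, gradient_xHingeLoss, smul_neg, sub_neg_eq_add]

theorem topSingularValue_nonneg {d k : ℕ} (M : Matrix (Fin d) (Fin k) ℝ) :
    0 ≤ topSingularValue M :=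
  LinearMap.singularValues_nonneg _ _

/-- The eigenvalues of `(w₁, w₂) ↦ (Mᵀ w₂, M w₁)` are bounded by the largest singular value. -/
theorem abs_le_of_hasEigenvalue_crossOperator {d k : ℕ} {M : Matrix (Fin d) (Fin k) ℝ} {μ : ℝ}
    (hμ : Module.End.HasEigenvalue (crossOperator M) μ) : |μ| ≤ topSingularValue M := by
  obtain ⟨v, hv⟩ := hμ.exists_hasEigenvector
  have h := hv.apply_eq_smul
  have h1 : Mᵀ *ᵥ outputPart v = μ • filterPart v := by
    rw [← filterPart_crossOperator, h]
    rfl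
  have h2 : M *ᵥ filterPart v = μ • outputPart v := by
    rw [← outputPart_crossOperator, h]
    rfl
  rcases eq_or_ne μ 0 with rfl | hμ0
  · simpa using topSingularValue_nonneg M
  have hx : filterPart v ≠ 0 := by
    intro hx
    refine hv.2 (weights_ext hx ?_)
    rw [hx, mulVec_zero] at h2
    exact (smul_eq_zero_iff_right hμ0).1 h2.symm
  -- Eliminating the output layer turns an eigenvalue μ of the block operator into the eigenvalue μ²
  -- of the Gram matrix.
  have hgram : (Mᵀ * M) *ᵥ filterPart v = μ ^ 2 • filterPart v := by
    rw [← mulVec_mulVec, h2, mulVec_smul, h1, smul_smul, sq]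
  have hpsd := (posSemidef_topSingularValue_sub_gram M).dotProduct_mulVec_nonneg (filterPart v)
  rw [sub_mulVec, smul_mulVec, one_mulVec, hgram, ← sub_smul, dotProduct_smul, star_trivial,
    smul_eq_mul] at hpsd
  have hxx : 0 < filterPart v ⬝ᵥ filterPart v := by
    simpa using (dotProduct_star_self_pos_iff (v := filterPart v)).2 hx
  refine abs_le_of_sq_le_sq ?_ (topSingularValue_nonneg M)
  nlinarith [nonneg_of_mul_nonneg_left hpsd hxx]

/-- The rescaled iterates converge, and their limit is fixed by the dynamics up to the factor
`σ₁`. -/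
theorem exists_tendsto_scaledIterate {d k n : ℕ} {α : ℝ} (hα : 0 < α) (D : TrainSet d n)
    (w₁ : EuclideanSpace ℝ (Fin k)) :
    ∃ w : Weights d k, Tendsto (scaledIterate α D w₁) atTop (𝓝 w) ∧
      crossOperator (trainMatrix k D) w = topSingularValue (trainMatrix k D) • w :=
  exists_tendsto_rescaled_iterate (crossOperator_isSymmetric _) hα (topSingularValue_nonneg _)
    (fun _ => abs_le_of_hasEigenvalue_crossOperator) (gdIterate_succ α D w₁) 2

/-- `limUnder` is a genuine limit only because convergence has been established. -/
theorem tendsto_scaledIterate {d k n : ℕ} {α : ℝ} (hα : 0 < α) (D : TrainSet d n)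
    (w₁ : EuclideanSpace ℝ (Fin k)) :
    Tendsto (scaledIterate α D w₁) atTop (𝓝 (limitWeights α D w₁)) := by
  obtain ⟨w, hw, -⟩ := exists_tendsto_scaledIterate hα D w₁
  exact tendsto_nhds_limUnder ⟨w, hw⟩

theorem crossOperator_limitWeights {d k n : ℕ} {α : ℝ} (hα : 0 < α) (D : TrainSet d n)
    (w₁ : EuclideanSpace ℝ (Fin k)) :
    crossOperator (trainMatrix k D) (limitWeights α D w₁) =
      topSingularValue (trainMatrix k D) • limitWeights α D w₁ := by
  obtain ⟨w, hw, h⟩ := exists_tendsto_scaledIterate hα D w₁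
  rwa [tendsto_nhds_unique (tendsto_scaledIterate hα D w₁) hw]

theorem continuous_scaledIterate {d k n : ℕ} (α : ℝ) (D : TrainSet d n) (t : ℕ) :
    Continuous fun w₁ : EuclideanSpace ℝ (Fin k) => scaledIterate α D w₁ t := by
  suffices Continuous fun w₁ : EuclideanSpace ℝ (Fin k) => gdIterate α D w₁ t from
    this.const_smul (2 / (1 + α * topSingularValue (trainMatrix k D)) ^ t)
  induction t with
  | zero =>
    refine (PiLp.continuous_toLp 2 _).comp (continuous_pi fun i => ?_)
    cases i <;> simp <;> fun_prop
  | succ t ih =>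
    simp_rw [gdIterate_succ]
    exact ih.add (((crossOperator _).continuous_of_finiteDimensional.comp ih).const_smul α)

/-- For a fixed training set, the limit is a pointwise limit of maps continuous in the initial
filter. -/
theorem measurable_limitWeights {d k n : ℕ} {α : ℝ} (hα : 0 < α) (D : TrainSet d n) :
    Measurable fun w₁ : EuclideanSpace ℝ (Fin k) => limitWeights α D w₁ :=
  measurable_of_tendsto_metrizable (fun t => (continuous_scaledIterate α D t).measurable)
    (tendsto_pi_nhds.2 fun w₁ => tendsto_scaledIterate hα D w₁)

/-- If the Gram matrix of the training matrix is primitive, then there is a direction `v ≠ 0`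
such that for initial filters not orthogonal to `v` the entries of the limiting filter have the
same strict sign, and the limiting output layer is a positive multiple of `M w₁`. -/
theorem exists_limitWeights_pos {d k n : ℕ} (hk : 0 < k) {α : ℝ} (hα : 0 < α) (D : TrainSet d n)
    (hprim : ((trainMatrix k D)ᵀ * trainMatrix k D).IsPrimitive) :
    ∃ v : EuclideanSpace ℝ (Fin k), v ≠ 0 ∧ ∀ w₁, inner ℝ v w₁ ≠ 0 →
      (∀ i j, 0 < filterPart (limitWeights α D w₁) i * filterPart (limitWeights α D w₁) j) ∧
      ∃ c : ℝ, 0 < c ∧ outputPart (limitWeights α D w₁) =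
        c • (trainMatrix k D *ᵥ filterPart (limitWeights α D w₁)) := by
  set M := trainMatrix k D
  set σ := topSingularValue M
  obtain ⟨v, hv0, hv⟩ := exists_gram_eigenvector hk M
  have hpsd := posSemidef_topSingularValue_sub_gram M
  have hσ2 := (eigenvector_mul_pos_of_isPrimitive hprim hpsd hv0 hv).1
  have hσ : 0 < σ := lt_of_le_of_ne (topSingularValue_nonneg M) fun h => by
    change 0 < σ ^ 2 at hσ2
    simp [← h] at hσ2
  refine ⟨WithLp.toLp 2 v, by simpa using hv0, fun w₁ hw₁ => ?_⟩
  set w := limitWeights α D w₁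
  have hw : crossOperator M w = σ • w := crossOperator_limitWeights hα D w₁
  have h1 : Mᵀ *ᵥ outputPart w = σ • filterPart w := by
    rw [← filterPart_crossOperator, hw]
    rfl
  have h2 : M *ᵥ filterPart w = σ • outputPart w := by
    rw [← outputPart_crossOperator, hw]
    rfl
  have hout : outputPart w = σ⁻¹ • (M *ᵥ filterPart w) := by
    rw [h2, inv_smul_smul₀ hσ.ne']
  -- The Gram eigenvector v lifts to a σ-eigenvector of the block operator. Pairing with it shows
  -- that the limit is nonzero, since ⟨w^∞, u⟩ = 2⟨v, w₁⟩.
  set u : Weights d k := WithLp.toLp 2 (Sum.elim v (σ⁻¹ • (M *ᵥ v)))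
  have hu1 : filterPart u = v := rfl
  have hu2 : outputPart u = σ⁻¹ • (M *ᵥ v) := rfl
  have hu : crossOperator M u = σ • u := by
    refine weights_ext ?_ ?_
    · rw [filterPart_crossOperator, hu2, mulVec_smul, mulVec_mulVec, hv, smul_smul]
      change (σ⁻¹ * σ ^ 2) • v = σ • v
      rw [sq, inv_mul_cancel_left₀ hσ.ne']
    · rw [outputPart_crossOperator, hu1]
      change _ = σ • (σ⁻¹ • (M *ᵥ v))
      rw [smul_inv_smul₀ hσ.ne']
  have hinner : inner ℝ w u = 2 * inner ℝ (gdIterate α D w₁ 0) u :=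
    inner_rescaled_limit (crossOperator_isSymmetric M) (by positivity) (gdIterate_succ α D w₁)
      (tendsto_scaledIterate hα D w₁) hu
  have hinit : inner ℝ (gdIterate α D w₁ 0) u = inner ℝ (WithLp.toLp 2 v) w₁ := by
    have ha : filterPart (gdIterate α D w₁ 0) = w₁.ofLp := rfl
    have hb : outputPart (gdIterate α D w₁ 0) = 0 := rfl
    rw [inner_weights, ha, hb, hu1, zero_dotProduct, add_zero,
      EuclideanSpace.inner_eq_star_dotProduct, star_trivial]
  have hx : filterPart w ≠ 0 := by
    intro hx
    have hw0 : w = 0 := by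
      refine weights_ext hx ?_
      rw [hout, hx, mulVec_zero, smul_zero]
      rfl
    rw [hw0, inner_zero_left, hinit] at hinner
    exact hw₁ (by linarith)
  have hgram : (Mᵀ * M) *ᵥ filterPart w = σ ^ 2 • filterPart w := by
    rw [← mulVec_mulVec, h2, mulVec_smul, h1, smul_smul, sq]
  exact ⟨(eigenvector_mul_pos_of_isPrimitive hprim hpsd hx hgram).2,
    σ⁻¹, inv_pos.2 hσ, hout⟩

/-! ### Training matrices of the classification task -/

theorem shiftMatrix_neg {d : ℕ} (k : ℕ) (x : Fin d → ℝ) :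
    shiftMatrix k (-x) = -shiftMatrix k x := by
  ext i j
  by_cases h : (i : ℕ) + j < d <;> simp [shiftMatrix, h]

theorem shiftMatrix_single {d k : ℕ} (l : Fin d) (i : Fin d) (j : Fin k) :
    shiftMatrix k (Pi.single l (1 : ℝ)) i j = if (i : ℕ) + j = l then 1 else 0 := by
  simp only [shiftMatrix, of_apply, Pi.single_apply, Fin.ext_iff]
  split_ifs <;> first | rfl | omega

theorem convNet_neg {d k : ℕ} (w : Weights d k) (x : Fin d → ℝ) :
    convNet w (-x) = -convNet w x := by
  simp [convNet_eq, shiftMatrix_neg, neg_mulVec]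

theorem label_smul_shiftMatrix_nonneg {d : ℕ} (k : ℕ) {p : DataPoint d} (hp : p ∈ taskClsData d)
    (i : Fin d) (j : Fin k) : 0 ≤ (p.2 • shiftMatrix k p.1) i j := by
  obtain ⟨l, rfl | rfl⟩ := hp
  · simp only [one_smul, shiftMatrix_single]
    split_ifs <;> simp
  · simp only [shiftMatrix_neg, smul_neg, neg_smul, one_smul, neg_neg, shiftMatrix_single]
    split_ifs <;> simp

/-- Basis vectors and their negatives are all distinct, so the input determines the label, whose
sign cancels that of the input. -/
theorem label_smul_shiftMatrix_pos {d k : ℕ} {p : DataPoint d} (hp : p ∈ taskClsData d)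
    {l : Fin d} (hl : p.1 = Pi.single l 1 ∨ p.1 = -Pi.single l 1) {i : Fin d} {j : Fin k}
    (hij : (i : ℕ) + j = l) : 0 < (p.2 • shiftMatrix k p.1) i j := by
  have hsame : ∀ {l l' : Fin d}, (Pi.single l 1 : Fin d → ℝ) = Pi.single l' 1 → l = l' := by
    intro l l' h
    by_contra hne
    simpa [hne] using congrFun h l
  have hopp : ∀ {l l' : Fin d}, (Pi.single l 1 : Fin d → ℝ) ≠ -Pi.single l' 1 := by
    intro l l' h
    have h1 : (0 : ℝ) ≤ (Pi.single l' 1 : Fin d → ℝ) l := by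
      rw [Pi.single_apply]
      split_ifs <;> simp
    have h2 := congrFun h l
    rw [Pi.single_eq_same, Pi.neg_apply] at h2
    linarith
  obtain ⟨l', rfl | rfl⟩ := hp
  · obtain rfl : l = l' := hl.elim (fun h => (hsame h).symm) fun h => (hopp h).elim
    simp [shiftMatrix_single, hij]
  · obtain rfl : l = l' :=
      hl.elim (fun h => (hopp h.symm).elim) fun h => (hsame (neg_injective h)).symm
    simp [shiftMatrix_neg, shiftMatrix_single, hij]

theorem trainMatrix_apply {d k n : ℕ} (D : TrainSet d n) (i : Fin d) (j : Fin k) :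
    trainMatrix k D i j = (1 / (n : ℝ)) * ∑ s, ((D s).2 • shiftMatrix k (D s).1) i j := by
  rw [trainMatrix, Matrix.smul_apply, Matrix.sum_apply, smul_eq_mul]

theorem trainMatrix_nonneg {d k n : ℕ} {D : TrainSet d n} (hD : ∀ s, D s ∈ taskClsData d)
    (i : Fin d) (j : Fin k) : 0 ≤ trainMatrix k D i j := by
  rw [trainMatrix_apply]
  exact mul_nonneg (by positivity)
    (Finset.sum_nonneg fun s _ => label_smul_shiftMatrix_nonneg k (hD s) i j)

theorem trainMatrix_pos {d k n : ℕ} {D : TrainSet d n} (hD : ∀ s, D s ∈ taskClsData d)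
    {l : Fin d} (hl : l ∈ trainPositions D) {i : Fin d} {j : Fin k} (hij : (i : ℕ) + j = l) :
    0 < trainMatrix k D i j := by
  obtain ⟨s, hs⟩ := hl
  have hn : 0 < n := s.pos
  rw [trainMatrix_apply]
  exact mul_pos (by positivity)
    (Finset.sum_pos' (fun s _ => label_smul_shiftMatrix_nonneg k (hD s) i j)
      ⟨s, Finset.mem_univ _, label_smul_shiftMatrix_pos (hD s) hs hij⟩)

/-! ### Margins of the limiting network -/

/-- Expanded as a double sum, only products x i * x j occur, so it does not matter which common sign
x has. -/
theorem dotProduct_mul_dotProduct_nonneg {k : ℕ} {a b x : Fin k → ℝ} (ha : ∀ j, 0 ≤ a j)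
    (hb : ∀ j, 0 ≤ b j) (hx : ∀ i j, 0 < x i * x j) : 0 ≤ (a ⬝ᵥ x) * (b ⬝ᵥ x) := by
  rw [dotProduct, dotProduct, Finset.sum_mul_sum]
  refine Finset.sum_nonneg fun i _ => Finset.sum_nonneg fun j _ => ?_
  rw [mul_mul_mul_comm]
  exact mul_nonneg (mul_nonneg (ha i) (hb j)) (hx i j).le

theorem dotProduct_mul_dotProduct_pos {k : ℕ} {a b x : Fin k → ℝ} (ha : ∀ j, 0 ≤ a j)
    (hb : ∀ j, 0 ≤ b j) (hx : ∀ i j, 0 < x i * x j) {i j : Fin k} (hi : 0 < a i) (hj : 0 < b j) :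
    0 < (a ⬝ᵥ x) * (b ⬝ᵥ x) := by
  have hnn : ∀ i j, 0 ≤ a i * x i * (b j * x j) := fun i j => by
    rw [mul_mul_mul_comm]
    exact mul_nonneg (mul_nonneg (ha i) (hb j)) (hx i j).le
  rw [dotProduct, dotProduct, Finset.sum_mul_sum]
  refine Finset.sum_pos' (fun i _ => Finset.sum_nonneg fun j _ => hnn i j)
    ⟨i, Finset.mem_univ _, Finset.sum_pos' (fun j _ => hnn i j) ⟨j, Finset.mem_univ _, ?_⟩⟩
  rw [mul_mul_mul_comm]
  exact mul_pos (mul_pos hi hj) (hx i j)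

theorem convNet_of_outputPart_eq {d k : ℕ} {M : Matrix (Fin d) (Fin k) ℝ} {w : Weights d k} {c : ℝ}
    (hw : outputPart w = c • (M *ᵥ filterPart w)) (x : Fin d → ℝ) :
    convNet w x =
      c * ∑ i, (M i ⬝ᵥ filterPart w) * (shiftMatrix k x i ⬝ᵥ filterPart w) := by
  rw [convNet_eq, hw, smul_dotProduct, smul_eq_mul]
  rfl

theorem shiftMatrix_single_nonneg {d k : ℕ} (l i : Fin d) (j : Fin k) :
    0 ≤ shiftMatrix k (Pi.single l (1 : ℝ)) i j := by
  rw [shiftMatrix_single]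
  split_ifs <;> simp

theorem convNet_single_nonneg {d k : ℕ} {M : Matrix (Fin d) (Fin k) ℝ} (hM : ∀ i j, 0 ≤ M i j)
    {w : Weights d k} (hpos : ∀ i j, 0 < filterPart w i * filterPart w j) {c : ℝ} (hc : 0 < c)
    (hw : outputPart w = c • (M *ᵥ filterPart w)) (l : Fin d) :
    0 ≤ convNet w (Pi.single l 1) := by
  rw [convNet_of_outputPart_eq hw]
  exact mul_nonneg hc.le (Finset.sum_nonneg fun i _ =>
    dotProduct_mul_dotProduct_nonneg (hM i) (shiftMatrix_single_nonneg l i) hpos)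

theorem convNet_single_pos {d k : ℕ} {M : Matrix (Fin d) (Fin k) ℝ} (hM : ∀ i j, 0 ≤ M i j)
    {w : Weights d k} (hpos : ∀ i j, 0 < filterPart w i * filterPart w j) {c : ℝ} (hc : 0 < c)
    (hw : outputPart w = c • (M *ᵥ filterPart w)) {l i : Fin d} {j j' : Fin k}
    (hij : (i : ℕ) + j = l) (hij' : 0 < M i j') :
    0 < convNet w (Pi.single l 1) := by
  rw [convNet_of_outputPart_eq hw]
  refine mul_pos hc (Finset.sum_pos' (fun i _ =>
    dotProduct_mul_dotProduct_nonneg (hM i) (shiftMatrix_single_nonneg l i) hpos)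
    ⟨i, Finset.mem_univ _, dotProduct_mul_dotProduct_pos (hM i) (shiftMatrix_single_nonneg l i)
      hpos hij' (j := j) ?_⟩)
  simp [shiftMatrix_single, hij]

/-- Row i sees the positions i, …, i + k - 1, so i = min(l, l') works. -/
theorem exists_common_window {d k : ℕ} {l l' : Fin d} (h : |((l' : ℕ) : ℤ) - ((l : ℕ) : ℤ)| < k) :
    ∃ (i : Fin d) (j j' : Fin k), (i : ℕ) + j = l ∧ (i : ℕ) + j' = l' := by
  rw [abs_lt] at h
  rcases le_total (l : ℕ) (l' : ℕ) with hle | hle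
  · exact ⟨l, ⟨0, by omega⟩, ⟨l' - l, by omega⟩, by simp, by simp; omega⟩
  · exact ⟨l', ⟨l - l', by omega⟩, ⟨0, by omega⟩, by simp; omega, by simp⟩

/-! ### Margin errors and generalization error -/

theorem marginError_nonneg (z : ℝ) : 0 ≤ marginError z := by
  unfold marginError
  split_ifs <;> norm_num

theorem marginError_le_one (z : ℝ) : marginError z ≤ 1 := by
  unfold marginError
  split_ifs <;> linarith

theorem marginError_of_pos {z : ℝ} (hz : 0 < z) : marginError z = 0 := by
  simp [marginError, hz.not_gt, hz.ne']

theorem marginError_le_half {z : ℝ} (hz : 0 ≤ z) : marginError z ≤ 1 / 2 := by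
  unfold marginError
  rw [if_neg hz.not_gt]
  split_ifs <;> norm_num

theorem measurable_marginError : Measurable marginError :=
  (Measurable.ite measurableSet_Iio measurable_const measurable_const).add
    ((Measurable.ite (measurableSet_singleton 0) measurable_const measurable_const).const_mul _)

/-- The data points of the classification task, indexed by position and sign. -/
def taskClsPoint {d : ℕ} (q : Fin d × Bool) : DataPoint d :=
  if q.2 then (Pi.single q.1 1, 1) else (-Pi.single q.1 1, -1)

theorem taskClsPoint_injective {d : ℕ} : Function.Injective (taskClsPoint (d := d)) := by
  rintro ⟨l, s⟩ ⟨l', s'⟩ h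
  have hs : s = s' := by
    have := congrArg Prod.snd h
    cases s <;> cases s' <;> simp [taskClsPoint] at this ⊢ <;> norm_num at this
  subst hs
  have hl := congrFun (congrArg Prod.fst h) l
  have : l = l' := by
    by_contra hne
    cases s <;> simp [taskClsPoint, hne] at hl
  rw [this]

theorem taskClsData_eq_image (d : ℕ) :
    taskClsData d = ((Finset.univ.image taskClsPoint : Finset (DataPoint d)) : Set (DataPoint d)) := by
  ext p
  simp only [taskClsData, Set.mem_ofPred_eq, Finset.coe_image, Finset.coe_univ, Set.image_univ,
    Set.mem_range, Prod.exists, Bool.exists_bool, taskClsPoint]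
  refine exists_congr fun l => ?_
  simp [eq_comm, or_comm]

theorem taskClsData_finite (d : ℕ) : (taskClsData d).Finite := by
  rw [taskClsData_eq_image]
  exact Finset.finite_toSet _

theorem isProbabilityMeasure_taskCls {d : ℕ} (hd : 0 < d) : IsProbabilityMeasure (taskCls d) :=
  isProbabilityMeasure_uniformOn (taskClsData_finite d)
    ⟨(Pi.single ⟨0, hd⟩ 1, 1), ⟨0, hd⟩, Or.inl rfl⟩

theorem ae_mem_taskClsData (d : ℕ) : ∀ᵐ p ∂taskCls d, p ∈ taskClsData d :=
  ae_cond_mem (taskClsData_finite d).measurableSet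

/-- The network is odd in its input, so (e_l, 1) and (-e_l, -1) have equal margins and 2d points
reduce to d. -/
theorem genError_taskCls {d k : ℕ} (w : Weights d k) :
    genError (taskCls d) w = (1 / (d : ℝ)) * ∑ l, marginError (convNet w (Pi.single l 1)) := by
  have hcount : (Measure.count (taskClsData d)).toReal = 2 * d := by
    rw [taskClsData_eq_image, Measure.count_apply_finset,
      Finset.card_image_of_injective _ taskClsPoint_injective]
    simp [mul_comm]
  have hint : ∫ p in taskClsData d, marginError (p.2 * convNet w p.1) ∂Measure.count =
      2 * ∑ l, marginError (convNet w (Pi.single l 1)) := by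
    have hfin : IntegrableOn (fun p : DataPoint d => marginError (p.2 * convNet w p.1))
        (taskClsData d) Measure.count := by
      rw [← Set.biUnion_of_singleton (taskClsData d),
        integrableOn_finite_biUnion (taskClsData_finite d)]
      exact fun p _ => integrableOn_singleton (by simp) (by simp)
    rw [taskClsData_eq_image] at hfin ⊢
    rw [setIntegral_finset _ hfin,
      Finset.sum_image taskClsPoint_injective.injOn, Fintype.sum_prod_type, Finset.mul_sum]
    refine Finset.sum_congr rfl fun l _ => ?_
    simp [taskClsPoint, convNet_neg, measureReal_def]
    ring
  rw [genError, taskCls, uniformOn, ProbabilityTheory.cond, integral_smul_measure,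
    ENNReal.toReal_inv, hcount, hint, smul_eq_mul, mul_inv]
  ring

theorem genError_taskCls_nonneg {d k : ℕ} (w : Weights d k) : 0 ≤ genError (taskCls d) w := by
  rw [genError_taskCls]
  exact mul_nonneg (by positivity) (Finset.sum_nonneg fun l _ => marginError_nonneg _)

theorem genError_taskCls_le_one {d k : ℕ} (w : Weights d k) : genError (taskCls d) w ≤ 1 := by
  rw [genError_taskCls]
  have h : ∑ l : Fin d, marginError (convNet w (Pi.single l 1)) ≤ d := by
    simpa using Finset.sum_le_sum fun (l : Fin d) (_ : l ∈ Finset.univ) =>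
      marginError_le_one (convNet w (Pi.single l 1))
  calc _ ≤ 1 / (d : ℝ) * d := by gcongr
    _ ≤ 1 := by rw [one_div]; exact inv_mul_le_one

theorem measurable_genError_taskCls (d k : ℕ) :
    Measurable fun w : Weights d k => genError (taskCls d) w := by
  simp_rw [genError_taskCls]
  refine (Finset.measurable_sum _ fun l _ => measurable_marginError.comp ?_).const_mul _
  unfold convNet
  fun_prop

/-- The training sets all of whose positions are at distance at least `k` from `l`. -/
def farTrainSets (d k n : ℕ) (l : Fin d) : Set (TrainSet d n) :=
  {D | ∀ l' ∈ trainPositions D, (k : ℤ) ≤ |((l' : ℕ) : ℤ) - ((l : ℕ) : ℤ)|}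

theorem genError_le_of_limit_form {d k n : ℕ} {D : TrainSet d n} (hD : ∀ s, D s ∈ taskClsData d)
    {w : Weights d k} (hpos : ∀ i j, 0 < filterPart w i * filterPart w j) {c : ℝ} (hc : 0 < c)
    (hw : outputPart w = c • (trainMatrix k D *ᵥ filterPart w)) :
    genError (taskCls d) w ≤
      (1 / 2) * ((1 / (d : ℝ)) * ∑ l, (farTrainSets d k n l).indicator (fun _ => (1 : ℝ)) D) := by
  rw [genError_taskCls, mul_left_comm, Finset.mul_sum (a := 1 / 2)]
  gcongr with l
  by_cases h : D ∈ farTrainSets d k n l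
  · rw [Set.indicator_of_mem h, mul_one]
    exact marginError_le_half (convNet_single_nonneg (trainMatrix_nonneg hD) hpos hc hw l)
  · rw [Set.indicator_of_notMem h, mul_zero]
    simp only [farTrainSets, Set.mem_ofPred_eq, not_forall, not_le] at h
    obtain ⟨l', hl', hlt⟩ := h
    obtain ⟨i, j, j', hij, hij'⟩ := exists_common_window hlt
    exact (marginError_of_pos (convNet_single_pos (trainMatrix_nonneg hD) hpos hc hw hij
      (trainMatrix_pos hD hl' hij'))).le

/-! ### Integration over the training set and the initial filter -/

instance isProbabilityMeasure_filterLaw (k : ℕ) (b : ℝ) : IsProbabilityMeasure (filterLaw k b) := by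
  unfold filterLaw
  infer_instance

/-- A centred isotropic Gaussian vector is almost surely not orthogonal to a given direction. -/
theorem ae_filterLaw_inner_ne_zero {k : ℕ} {b : ℝ} (hb : 0 < b) {v : EuclideanSpace ℝ (Fin k)}
    (hv : v ≠ 0) : ∀ᵐ w ∂filterLaw k b, inner ℝ v w ≠ 0 := by
  have hS : (b ^ 2 • (1 : Matrix (Fin k) (Fin k) ℝ)).PosSemidef :=
    PosSemidef.one.smul (sq_nonneg b)
  -- The variance of ⟨v, w⟩ is b²‖v‖² > 0, so its Gaussian law has no atom at 0.
  have hvar : 0 < Var[innerSL ℝ v; filterLaw k b] := by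
    have h1 : Var[innerSL ℝ v; filterLaw k b] = covarianceBilin (filterLaw k b) v v := by
      unfold filterLaw
      rw [covarianceBilin_self IsGaussian.memLp_two_id]
      rfl
    have hvv : 0 < v.ofLp ⬝ᵥ v.ofLp := by
      simpa using (dotProduct_star_self_pos_iff (v := v.ofLp)).2 (by simpa using hv)
    rw [h1, filterLaw, covarianceBilin_multivariateGaussian hS, smul_mulVec, one_mulVec,
      dotProduct_smul, smul_eq_mul]
    positivity
  have hmap : (filterLaw k b).map (innerSL ℝ v) =
      gaussianReal _ (Var[innerSL ℝ v; filterLaw k b]).toNNReal :=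
    IsGaussian.map_eq_gaussianReal (μ := multivariateGaussian 0 _) (innerSL ℝ v)
  have hnull : NullSingletonClass ((filterLaw k b).map (innerSL ℝ v)) := by
    rw [hmap]
    exact nullSingletonClass_gaussianReal (Real.toNNReal_pos.2 hvar).ne'
  have h0 : ∀ᵐ z ∂(filterLaw k b).map (innerSL ℝ v), z ≠ 0 := by
    simpa only [ae_iff, not_not, Set.ofPred_eq_eq_singleton] using hnull.measure_singleton 0
  exact ae_of_ae_map (innerSL ℝ v).continuous.aemeasurable h0

/-- Every set agrees almost everywhere with a finite one. This spares separate measurability proofs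
for the events of training sets. -/
theorem nullMeasurableSet_of_ae_mem_finite {X : Type*} [MeasurableSpace X]
    [MeasurableSingletonClass X] {μ : Measure X} {T : Set X} (hT : T.Finite)
    (h : ∀ᵐ x ∂μ, x ∈ T) (s : Set X) : NullMeasurableSet s μ := by
  refine (hT.subset Set.inter_subset_right : (s ∩ T).Finite).measurableSet.nullMeasurableSet.congr ?_
  filter_upwards [h] with x hx
  exact propext ⟨fun hs => hs.1, fun hs => ⟨hs, hx⟩⟩

/-- A function on a product is almost everywhere measurable if the law of the first coordinate is
carried by a finite set and the sections in the second coordinate are measurable. -/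
theorem aemeasurable_prod_of_finite {X Y : Type*} [MeasurableSpace X] [MeasurableSpace Y]
    [MeasurableSingletonClass X] {μ : Measure X} {ν : Measure Y} [SFinite ν] {T : Set X}
    (hT : T.Finite) (h : ∀ᵐ x ∂μ, x ∈ T) {f : X × Y → ℝ} (hf : ∀ x, Measurable fun y => f (x, y)) :
    AEMeasurable f (μ.prod ν) := by
  classical
  -- The measurable representative glues the sections over the finitely many points of `T` and is 0
  -- elsewhere.
  refine ⟨fun q => ∑ x ∈ hT.toFinset, (Prod.fst ⁻¹' {x}).indicator (fun q => f (x, q.2)) q, ?_, ?_⟩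
  · exact Finset.measurable_sum _ fun x _ =>
      ((hf x).comp measurable_snd).indicator (measurable_fst (measurableSet_singleton x))
  · filter_upwards [Measure.quasiMeasurePreserving_fst.ae h] with q hq
    rw [Finset.sum_eq_single_of_mem q.1 (hT.mem_toFinset.2 hq)]
    · simp
    · intro x _ hx
      exact Set.indicator_of_notMem (fun hq' => hx hq'.symm) _

/-- The training sets all of whose points are data points of the classification task. -/
def taskClsTrainSets (d n : ℕ) : Set (TrainSet d n) := {D | ∀ s, D s ∈ taskClsData d}

theorem taskClsTrainSets_finite (d n : ℕ) : (taskClsTrainSets d n).Finite :=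
  (Set.Finite.pi' fun _ => taskClsData_finite d)

theorem ae_mem_taskClsTrainSets {d : ℕ} (hd : 0 < d) (n : ℕ) :
    ∀ᵐ D ∂trainLaw (taskCls d) n, D ∈ taskClsTrainSets d n := by
  have := isProbabilityMeasure_taskCls hd
  exact ae_all_iff.2 fun s => Measure.tendsto_eval_ae_ae.eventually (ae_mem_taskClsData d)

theorem isProbabilityMeasure_trainLaw {d : ℕ} (hd : 0 < d) (n : ℕ) :
    IsProbabilityMeasure (trainLaw (taskCls d) n) := by
  have := isProbabilityMeasure_taskCls hd
  unfold trainLaw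
  infer_instance

theorem integrable_genError_limitWeights {d : ℕ} (hd : 0 < d) (k n : ℕ) {α : ℝ} (hα : 0 < α)
    (b : ℝ) :
    Integrable (fun q : TrainSet d n × EuclideanSpace ℝ (Fin k) =>
        genError (taskCls d) (limitWeights α q.1 q.2))
      ((trainLaw (taskCls d) n).prod (filterLaw k b)) := by
  have := isProbabilityMeasure_trainLaw hd n
  refine Integrable.of_bound (AEMeasurable.aestronglyMeasurable ?_) 1 (ae_of_all _ fun q => ?_)
  · exact aemeasurable_prod_of_finite (taskClsTrainSets_finite d n)
      (ae_mem_taskClsTrainSets hd n) fun D =>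
        (measurable_genError_taskCls d k).comp (measurable_limitWeights hα D)
  · rw [Real.norm_of_nonneg (genError_taskCls_nonneg _)]
    exact genError_taskCls_le_one _

/-- The training sets whose Gram matrix is not primitive. -/
def nonprimitiveTrainSets (d k n : ℕ) : Set (TrainSet d n) :=
  {D | ¬ ((trainMatrix k D)ᵀ * trainMatrix k D).IsPrimitive}

/-- Conditionally on the training set, the error bound holds for almost every initial filter. -/
theorem ae_genError_limitWeights_le {d k n : ℕ} (hk : 0 < k) {α b : ℝ} (hα : 0 < α) (hb : 0 < b)
    {D : TrainSet d n} (hD : D ∈ taskClsTrainSets d n) :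
    ∀ᵐ w₁ ∂filterLaw k b, genError (taskCls d) (limitWeights α D w₁) ≤
      (nonprimitiveTrainSets d k n).indicator (fun _ => (1 : ℝ)) D +
        (1 / 2) * ((1 / (d : ℝ)) * ∑ l, (farTrainSets d k n l).indicator (fun _ => (1 : ℝ)) D) := by
  by_cases h : D ∈ nonprimitiveTrainSets d k n
  · refine ae_of_all _ fun w₁ => ?_
    rw [Set.indicator_of_mem h]
    refine (genError_taskCls_le_one _).trans (le_add_of_nonneg_right ?_)
    have : ∀ l, 0 ≤ (farTrainSets d k n l).indicator (fun _ => (1 : ℝ)) D :=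
      fun l => Set.indicator_nonneg (fun _ _ => zero_le_one) D
    have := Finset.sum_nonneg fun l (_ : l ∈ Finset.univ) => this l
    positivity
  · obtain ⟨v, hv, hpos⟩ := exists_limitWeights_pos hk hα D (not_not.1 h)
    filter_upwards [ae_filterLaw_inner_ne_zero hb hv] with w₁ hw₁
    obtain ⟨hsign, c, hc, hout⟩ := hpos w₁ hw₁
    rw [Set.indicator_of_notMem h, zero_add]
    exact genError_le_of_limit_form hD hsign hc hout

theorem asymGenError_taskCls_le {d k : ℕ} (hk : 0 < k) (hd : 0 < d) (n : ℕ) {α b : ℝ}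
    (hα : 0 < α) (hb : 0 < b) :
    asymGenError (taskCls d) k n α b ≤
      (trainLaw (taskCls d) n).real (nonprimitiveTrainSets d k n) +
        (1 / 2) * ((1 / (d : ℝ)) * ∑ l, (trainLaw (taskCls d) n).real (farTrainSets d k n l)) := by
  have := isProbabilityMeasure_trainLaw hd n
  set μ := trainLaw (taskCls d) n
  have hmeas : ∀ s : Set (TrainSet d n), NullMeasurableSet s μ :=
    nullMeasurableSet_of_ae_mem_finite (taskClsTrainSets_finite d n) (ae_mem_taskClsTrainSets hd n)
  have hint : ∀ s : Set (TrainSet d n), Integrable (s.indicator fun _ => (1 : ℝ)) μ :=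
    fun s => (integrable_const 1).indicator₀ (hmeas s)
  have hval : ∀ s : Set (TrainSet d n), ∫ D, s.indicator (fun _ => (1 : ℝ)) D ∂μ = μ.real s :=
    fun s => by
      rw [integral_indicator₀ (hmeas s)]
      simp
  set g : TrainSet d n → ℝ := fun D => (nonprimitiveTrainSets d k n).indicator (fun _ => (1 : ℝ)) D +
    (1 / 2) * ((1 / (d : ℝ)) * ∑ l, (farTrainSets d k n l).indicator (fun _ => (1 : ℝ)) D) with hg
  have hsum : Integrable (fun D => (1 / 2) * ((1 / (d : ℝ)) *
      ∑ l, (farTrainSets d k n l).indicator (fun _ => (1 : ℝ)) D)) μ :=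
    ((integrable_finsetSum _ fun l _ => hint (farTrainSets d k n l)).const_mul _).const_mul _
  have hgint : Integrable g μ := (hint _).add hsum
  have hgval : ∫ D, g D ∂μ = μ.real (nonprimitiveTrainSets d k n) +
      (1 / 2) * ((1 / (d : ℝ)) * ∑ l, μ.real (farTrainSets d k n l)) := by
    rw [hg, integral_add (hint _) hsum, hval, integral_const_mul, integral_const_mul,
      integral_finsetSum _ fun l _ => hint (farTrainSets d k n l)]
    simp_rw [hval]
  -- The exceptional null set of filters depends on D; as only finitely many D matter, their union
  -- is still null.
  have hae : ∀ᵐ q ∂μ.prod (filterLaw k b), ∀ D ∈ taskClsTrainSets d n,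
      genError (taskCls d) (limitWeights α D q.2) ≤ g D :=
    (ae_ball_iff (taskClsTrainSets_finite d n).countable).2 fun D hD =>
      Measure.quasiMeasurePreserving_snd.ae (ae_genError_limitWeights_le hk hα hb hD)
  rw [← hgval, asymGenError]
  calc _ ≤ ∫ q : TrainSet d n × EuclideanSpace ℝ (Fin k), g q.1 ∂μ.prod (filterLaw k b) := by
        refine integral_mono_ae (integrable_genError_limitWeights hd k n hα b)
          (hgint.comp_fst (filterLaw k b)) ?_
        filter_upwards [hae,
          Measure.quasiMeasurePreserving_fst.ae (ae_mem_taskClsTrainSets hd n)] with q hq hqD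
        exact hq q.1 hqD
    _ = ∫ D, g D ∂μ := by
        rw [integral_fun_fst]
        simp

end ConvNet

end

theorem theorem2 (d k n : ℕ) (hk : 1 ≤ k) (hkd : k ≤ d) (hn : 1 ≤ n)
    (α b : ℝ) (hα : 0 < α) (hb : 0 < b) :
    -- the asymptotic weights exist for every training set and every initial filter
    (∀ (D : ConvNet.TrainSet d n) (w₁ : EuclideanSpace ℝ (Fin k)),
      Tendsto (ConvNet.scaledIterate α D w₁) atTop (𝓝 (ConvNet.limitWeights α D w₁))) ∧
    -- the expectation that defines the asymptotic generalization error exists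
    Integrable
      (fun q : ConvNet.TrainSet d n × EuclideanSpace ℝ (Fin k) =>
        ConvNet.genError (ConvNet.taskCls d) (ConvNet.limitWeights α q.1 q.2))
      ((ConvNet.trainLaw (ConvNet.taskCls d) n).prod (ConvNet.filterLaw k b)) ∧
    -- the bound
    ConvNet.asymGenError (ConvNet.taskCls d) k n α b ≤
      (ConvNet.trainLaw (ConvNet.taskCls d) n).real
          {D | ¬ ((ConvNet.trainMatrix k D)ᵀ * ConvNet.trainMatrix k D).IsPrimitive} +
        (1 / 2) * ((1 / (d : ℝ)) * ∑ l : Fin d,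
          (ConvNet.trainLaw (ConvNet.taskCls d) n).real
            {D | ∀ l' ∈ ConvNet.trainPositions D, (k : ℤ) ≤ |((l' : ℕ) : ℤ) - ((l : ℕ) : ℤ)|}) :=
  ⟨ConvNet.tendsto_scaledIterate hα,
    ConvNet.integrable_genError_limitWeights (hk.trans hkd) k n hα b,
    ConvNet.asymGenError_taskCls_le hk (hk.trans hkd) n hα hb⟩
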